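/- Let $G$ be a non-compact locally compact (Hausdorff) group. A unitary representation $\pi$ of $G$ is a homomorphism from $G$ into the unitary group of a complex Hilbert space $\mathcal H_\pi$ such that $s\mapsto\pi(s)\xi$ is continuous for every $\xi\in\mathcal H_\pi$; its matrix coefficients are the functions $\pi_{\xi,\eta}(s)=\langle\pi(s)\xi,\eta\rangle$ on $G$, for $\xi,\eta\in\mathcal H_\pi$. Let $B(G)$ be the Fourier–Stieltjes algebra, that is, the set of all matrix coefficients of all unitary representations of $G$ (a complex vector space under pointwise operations), let $C_0(G)$ be the space of continuous complex functions on $G$ vanishing at infinity, let $B_0(G)=B(G)\cap C_0(G)$, and let $1_G$ be the constant function $1$ on $G$. A unitary representation is purely infinite if it has no nonzero finite dimensional subrepresentation, and $A_{\mathcal{PI}}(G)$ is the set of all matrix coefficients of purely infinite unitary representations of $G$. The group $G$ has the Howe–Moore property if every unitary representation $\pi$ of $G$ either has a nonzero invariant vector or satisfies $\pi_{\xi,\eta}\in C_0(G)$ for all $\xi,\eta\in\mathcal H_\pi$. The group $G$ is minimally almost periodic if its almost periodic (Bohr) compactification $G^{\mathrm{AP}}$, i.e. the universal compact Hausdorff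 group receiving a continuous homomorphism with dense range from $G$, is trivial. Then the following are equivalent: 1. $G$ has the Howe–Moore property; 2. $B(G)=B_0(G)\oplus\mathbb C1_G$; 3. $G$ is minimally almost periodic and $A_{\mathcal{PI}}(G)=B_0(G)$. -/

import Mathlib

open Filter Topology
open scoped ZeroAtInfty

universe u

noncomputable section

namespace HoweMoore

/-- A (strongly continuous) unitary representation of `G` on a complex inner product space `H`;
it is only ever used with `H` complete. A unitary operator is a surjective linear isometry. -/
structure UnitaryRep (G : Type u) [Group G] [TopologicalSpace G]
    (H : Type u) [NormedAddCommGroup H] [InnerProductSpace ℂ H] where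
  /-- the underlying homomorphism into the unitary group of `H` -/
  toHom : G →* (H ≃ₗᵢ[ℂ] H)
  continuous_apply : ∀ ξ : H, Continuous fun g : G => toHom g ξ

namespace UnitaryRep

variable {G : Type u} [Group G] [TopologicalSpace G]
variable {H : Type u} [NormedAddCommGroup H] [InnerProductSpace ℂ H]
variable {K : Type u} [NormedAddCommGroup K] [InnerProductSpace ℂ K]

/-- The matrix coefficient `s ↦ ⟨π(s)ξ, η⟩`, the inner product being linear in the first variable
(Mathlib's `inner` is linear in the second one). -/
def coeff (π : UnitaryRep G H) (ξ η : H) : G → ℂ :=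
  fun s => inner ℂ η (π.toHom s ξ)

/-- `π` has a nonzero invariant vector. -/
def HasInvariantVector (π : UnitaryRep G H) : Prop :=
  ∃ ξ : H, ξ ≠ 0 ∧ ∀ g : G, π.toHom g ξ = ξ

/-- `π` is purely infinite: it has no nonzero finite dimensional subrepresentation. -/
def IsPurelyInfinite (π : UnitaryRep G H) : Prop :=
  ∀ W : Submodule ℂ H, (∀ g : G, ∀ w ∈ W, π.toHom g w ∈ W) → FiniteDimensional ℂ W → W = ⊥

/-- The trivial representation on `H`. -/
def trivial (G : Type u) [Group G] [TopologicalSpace G]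
    (H : Type u) [NormedAddCommGroup H] [InnerProductSpace ℂ H] : UnitaryRep G H where
  toHom := 1
  continuous_apply ξ := by simpa using continuous_const

/-- The Hilbert space direct sum of two representations. -/
def directSum (π : UnitaryRep G H) (σ : UnitaryRep G K) : UnitaryRep G (WithLp 2 (H × K)) where
  toHom :=
    { toFun := fun g => LinearIsometryEquiv.withLpProdCongr 2 (π.toHom g) (σ.toHom g)
      map_one' := by ext x <;> simp <;> rfl
      map_mul' := fun a b => by ext x <;> simp }
  continuous_apply ξ := by
    have h : Continuous fun g : G => (π.toHom g ξ.fst, σ.toHom g ξ.snd) :=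
      (π.continuous_apply ξ.fst).prodMk (σ.continuous_apply ξ.snd)
    exact (WithLp.prod_continuous_toLp 2 H K).comp h

end UnitaryRep

variable (G : Type u) [Group G] [TopologicalSpace G]

/-- The continuous functions `G → ℂ` vanishing at infinity, as a space of functions. -/
def zeroAtInfty : Submodule ℂ (G → ℂ) where
  carrier := {f | ∃ F : C₀(G, ℂ), (F : G → ℂ) = f}
  zero_mem' := ⟨0, rfl⟩
  add_mem' := by
    rintro _ _ ⟨F, rfl⟩ ⟨F', rfl⟩
    exact ⟨F + F', rfl⟩
  smul_mem' := by
    rintro c _ ⟨F, rfl⟩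
    exact ⟨c • F, rfl⟩

/-- The Fourier–Stieltjes algebra `B(G)` as a space of functions: all matrix coefficients of
unitary representations of `G` on Hilbert spaces. A matrix coefficient `⟨π(·)ξ, η⟩` only depends on
the cyclic subrepresentation generated by `ξ`, which is unitarily equivalent to one on a Hilbert
space in the universe of `G`. -/
def fourierStieltjes : Submodule ℂ (G → ℂ) where
  carrier := {u | ∃ (H : Type u) (_ : NormedAddCommGroup H) (_ : InnerProductSpace ℂ H)
    (_ : CompleteSpace H) (π : UnitaryRep G H) (ξ η : H), π.coeff ξ η = u}
  zero_mem' := by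
    refine ⟨EuclideanSpace ℂ PEmpty.{u + 1}, inferInstance, inferInstance, inferInstance,
      UnitaryRep.trivial G _, 0, 0, ?_⟩
    funext s
    simp [UnitaryRep.coeff]
  add_mem' := by
    rintro _ _ ⟨H, _, _, _, π, ξ, η, rfl⟩ ⟨K, _, _, _, σ, ξ', η', rfl⟩
    refine ⟨WithLp 2 (H × K), inferInstance, inferInstance, inferInstance,
      π.directSum σ, WithLp.toLp 2 (ξ, ξ'), WithLp.toLp 2 (η, η'), ?_⟩
    funext s
    simp [UnitaryRep.coeff, UnitaryRep.directSum]
  smul_mem' := by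
    rintro c _ ⟨H, _, _, _, π, ξ, η, rfl⟩
    refine ⟨H, inferInstance, inferInstance, inferInstance, π, c • ξ, η, ?_⟩
    funext s
    simp [UnitaryRep.coeff]

/-- The Rajchman algebra `B₀(G) = B(G) ∩ C₀(G)`. -/
def rajchman : Submodule ℂ (G → ℂ) :=
  fourierStieltjes G ⊓ zeroAtInfty G

/-- The set `A_PI(G)` of all matrix coefficients of purely infinite representations. -/
def purelyInfiniteCoeffs : Set (G → ℂ) :=
  {u | ∃ (H : Type u) (_ : NormedAddCommGroup H) (_ : InnerProductSpace ℂ H)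
    (_ : CompleteSpace H) (π : UnitaryRep G H) (ξ η : H),
    π.IsPurelyInfinite ∧ π.coeff ξ η = u}

/-- The Howe–Moore property: every unitary representation of `G` has a nonzero invariant vector, or
all its matrix coefficients vanish at infinity. -/
def HasHoweMooreProperty : Prop :=
  ∀ (H : Type u) [NormedAddCommGroup H] [InnerProductSpace ℂ H] [CompleteSpace H]
    (π : UnitaryRep G H),
    π.HasInvariantVector ∨ ∀ ξ η : H, π.coeff ξ η ∈ zeroAtInfty G

/-- A compact Hausdorff group together with a continuous homomorphism from `G` into it. A compact
Hausdorff group with a dense image of `G` has cardinality at most `2 ^ 2 ^ |G|`, so the universe of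
`G` is large enough. -/
structure CompactTarget : Type (u + 1) where
  carrier : Type u
  [group : Group carrier]
  [topologicalSpace : TopologicalSpace carrier]
  [isTopologicalGroup : IsTopologicalGroup carrier]
  [compactSpace : CompactSpace carrier]
  [t2Space : T2Space carrier]
  hom : G →ₜ* carrier

attribute [instance] CompactTarget.group CompactTarget.topologicalSpace
  CompactTarget.isTopologicalGroup CompactTarget.compactSpace CompactTarget.t2Space

/-- The diagonal homomorphism of `G` into the product of all its compact targets. -/
def toCompactTargets : G →ₜ* ((i : CompactTarget G) → i.carrier) where
  toFun g i := i.hom g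
  map_one' := by funext i; simp
  map_mul' a b := by funext i; simp
  continuous_toFun := continuous_pi fun i => i.hom.continuous_toFun

/-- The almost periodic (Bohr) compactification `G^AP`, the universal compact Hausdorff group that
receives a continuous homomorphism from `G` with dense range: the closure of the diagonal image of
`G` in the product of all its compact targets. -/
def APCompactification : Subgroup ((i : CompactTarget G) → i.carrier) :=
  (toCompactTargets G).toMonoidHom.range.topologicalClosure

/-- `G` is minimally almost periodic: its almost periodic compactification is trivial. -/
def IsMinimallyAlmostPeriodic : Prop :=
  Subsingleton (APCompactification G)

end HoweMoore

end

open MeasureTheory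

noncomputable section

namespace HoweMoore

namespace UnitaryRep

variable {G : Type u} [Group G] [TopologicalSpace G]
variable {H : Type u} [NormedAddCommGroup H] [InnerProductSpace ℂ H]

/-! Splitting off the invariant vectors writes any coefficient as a constant plus a coefficient of a
representation without nonzero invariant vectors. Under Howe–Moore the latter lies in `C₀`, whence
2. Conversely, 2 makes every coefficient converge at infinity. Each orbit then has a weak limit,
which is an invariant vector; if only zero is invariant, all coefficients vanish at infinity, which
is 1. Convergence also forces coefficients pulled back from a compact group to be constant, because
a compact group brings orbits back near the identity. As the regular representation of a compact
group is faithful, `G` has only trivial homomorphisms into such groups. Since `C₀` coefficients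
exclude finite dimensional subrepresentations, 3 follows. Given 3, a finite dimensional
subrepresentation maps `G` into a compact unitary group, hence is trivial. So absence of invariant
vectors means purely infinite, and the coefficients lie in `B₀(G)`. -/

theorem map_mul_apply (π : UnitaryRep G H) (a b : G) (ξ : H) :
    π.toHom (a * b) ξ = π.toHom a (π.toHom b ξ) := by
  rw [map_mul]; rfl

theorem map_one_apply (π : UnitaryRep G H) (ξ : H) : π.toHom 1 ξ = ξ := by
  rw [map_one]; rfl

theorem map_inv_map (π : UnitaryRep G H) (g : G) (ξ : H) :
    π.toHom g⁻¹ (π.toHom g ξ) = ξ := by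
  rw [← map_mul_apply, inv_mul_cancel, map_one_apply]

theorem map_map_inv (π : UnitaryRep G H) (g : G) (ξ : H) :
    π.toHom g (π.toHom g⁻¹ ξ) = ξ := by
  rw [← map_mul_apply, mul_inv_cancel, map_one_apply]

theorem inner_map_right (π : UnitaryRep G H) (g : G) (ξ η : H) :
    inner ℂ η (π.toHom g ξ) = inner ℂ (π.toHom g⁻¹ η) ξ := by
  rw [← LinearIsometryEquiv.inner_map_map (π.toHom g⁻¹), map_inv_map]

theorem continuous_coeff (π : UnitaryRep G H) (ξ η : H) : Continuous (π.coeff ξ η) :=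
  continuous_const.inner (π.continuous_apply ξ)

/-- The restriction of a unitary representation to an invariant subspace. -/
def restrict (π : UnitaryRep G H) (W : Submodule ℂ H)
    (hW : ∀ g : G, ∀ w ∈ W, π.toHom g w ∈ W) : UnitaryRep G W where
  toHom :=
    { toFun := fun g =>
        { toFun := fun w => ⟨π.toHom g w, hW g w w.2⟩
          map_add' := fun a b => Subtype.ext (by simp)
          map_smul' := fun c a => Subtype.ext (by simp)
          invFun := fun w => ⟨π.toHom g⁻¹ w, hW g⁻¹ w w.2⟩
          left_inv := fun w => Subtype.ext (π.map_inv_map g w)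
          right_inv := fun w => Subtype.ext (π.map_map_inv g w)
          norm_map' := fun w => (π.toHom g).norm_map w }
      map_one' := by
        ext w
        exact π.map_one_apply w
      map_mul' := fun a b => by
        ext w
        exact π.map_mul_apply a b w }
  continuous_apply w := (π.continuous_apply (w : H)).subtype_mk _

@[simp]
theorem coe_restrict_apply (π : UnitaryRep G H) (W : Submodule ℂ H)
    (hW : ∀ g : G, ∀ w ∈ W, π.toHom g w ∈ W) (g : G) (w : W) :
    (((π.restrict W hW).toHom g w : W) : H) = π.toHom g w := rfl

/-- The pullback of a unitary representation along a continuous homomorphism. -/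
def comap {K : Type u} [Group K] [TopologicalSpace K] (π : UnitaryRep K H) (φ : G →ₜ* K) :
    UnitaryRep G H where
  toHom := π.toHom.comp φ.toMonoidHom
  continuous_apply ξ := (π.continuous_apply ξ).comp φ.continuous_toFun

/-- The subspace of invariant vectors. -/
def invariants (π : UnitaryRep G H) : Submodule ℂ H where
  carrier := {ξ | ∀ g : G, π.toHom g ξ = ξ}
  zero_mem' g := map_zero _
  add_mem' ha hb g := by rw [map_add, ha g, hb g]
  smul_mem' c _ ha g := by rw [map_smul, ha g]

theorem mem_invariants {π : UnitaryRep G H} {ξ : H} :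
    ξ ∈ π.invariants ↔ ∀ g : G, π.toHom g ξ = ξ := Iff.rfl

theorem isClosed_invariants (π : UnitaryRep G H) : IsClosed (π.invariants : Set H) := by
  have h : (π.invariants : Set H) = ⋂ g : G, {ξ | π.toHom g ξ = ξ} := by
    ext ξ
    simp [mem_invariants]
  rw [h]
  exact isClosed_iInter fun g => isClosed_eq (π.toHom g).continuous continuous_id

instance [CompleteSpace H] (π : UnitaryRep G H) : CompleteSpace π.invariants :=
  π.isClosed_invariants.completeSpace_coe

theorem map_mem_orthogonal_invariants (π : UnitaryRep G H) (g : G) (w : H)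
    (hw : w ∈ π.invariantsᗮ) : π.toHom g w ∈ π.invariantsᗮ := by
  rw [Submodule.mem_orthogonal] at hw ⊢
  intro v hv
  rw [inner_map_right, hv g⁻¹]
  exact hw v hv

/-- The restriction to the orthogonal complement of the invariant vectors. -/
def nontrivialPart (π : UnitaryRep G H) : UnitaryRep G π.invariantsᗮ :=
  π.restrict _ π.map_mem_orthogonal_invariants

theorem not_hasInvariantVector_nontrivialPart (π : UnitaryRep G H) :
    ¬ π.nontrivialPart.HasInvariantVector := by
  rintro ⟨ξ, hξ, h⟩
  have hmem : (ξ : H) ∈ π.invariants := fun g => congrArg Subtype.val (h g)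
  exact hξ (Subtype.ext (inner_self_eq_zero.1 (Submodule.inner_right_of_mem_orthogonal hmem ξ.2)))

/-- A matrix coefficient is a constant plus a coefficient of the nontrivial part. -/
theorem exists_coeff_eq_add_const [CompleteSpace H] (π : UnitaryRep G H) (ξ η : H) :
    ∃ (c : ℂ) (ξ' η' : π.invariantsᗮ),
      π.coeff ξ η = π.nontrivialPart.coeff ξ' η' + c • (1 : G → ℂ) := by
  obtain ⟨x, hx, x', hx', rfl⟩ := π.invariants.exists_add_mem_mem_orthogonal ξ
  obtain ⟨y, hy, y', hy', rfl⟩ := π.invariants.exists_add_mem_mem_orthogonal η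
  refine ⟨inner ℂ y x, ⟨x', hx'⟩, ⟨y', hy'⟩, ?_⟩
  funext s
  have h1 : inner ℂ y (π.toHom s x') = 0 :=
    Submodule.inner_right_of_mem_orthogonal hy (π.map_mem_orthogonal_invariants s x' hx')
  have h2 : inner ℂ y' x = 0 := Submodule.inner_left_of_mem_orthogonal hx hy'
  simp only [coeff, Pi.add_apply, Pi.smul_apply, Pi.one_apply, smul_eq_mul, mul_one,
    Submodule.coe_inner, nontrivialPart, coe_restrict_apply]
  rw [map_add, hx s, inner_add_left, inner_add_right, inner_add_right, h1, h2]
  ring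

theorem IsPurelyInfinite.not_hasInvariantVector {π : UnitaryRep G H} (h : π.IsPurelyInfinite) :
    ¬ π.HasInvariantVector := by
  rintro ⟨ξ, hξ, hinv⟩
  -- An invariant vector spans a subrepresentation of dimension one.
  refine hξ (Submodule.span_singleton_eq_bot.1 (h (ℂ ∙ ξ) ?_ inferInstance))
  intro g w hw
  obtain ⟨c, rfl⟩ := Submodule.mem_span_singleton.1 hw
  rwa [map_smul, hinv g]

end UnitaryRep

/-! ### Functions vanishing at infinity -/

section ZeroAtInfty

variable {G : Type u} [TopologicalSpace G]

theorem mem_zeroAtInfty_iff {f : G → ℂ} :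
    f ∈ zeroAtInfty G ↔ Continuous f ∧ Tendsto f (cocompact G) (𝓝 0) := by
  constructor
  · rintro ⟨F, rfl⟩
    exact ⟨F.continuous, F.zero_at_infty'⟩
  · rintro ⟨hc, h0⟩
    exact ⟨⟨⟨f, hc⟩, h0⟩, rfl⟩

theorem eq_zero_of_smul_one_mem_zeroAtInfty [NoncompactSpace G] {c : ℂ}
    (h : c • (1 : G → ℂ) ∈ zeroAtInfty G) : c = 0 := by
  have h0 := (mem_zeroAtInfty_iff.1 h).2
  have h1 : c • (1 : G → ℂ) = fun _ => c := by
    funext s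
    simp
  rw [h1] at h0
  exact tendsto_nhds_unique tendsto_const_nhds h0

end ZeroAtInfty

theorem disjoint_rajchman_span_one (G : Type u) [Group G] [TopologicalSpace G]
    [NoncompactSpace G] : Disjoint (rajchman G) (Submodule.span ℂ {(1 : G → ℂ)}) := by
  rw [Submodule.disjoint_def]
  rintro f hf hf'
  obtain ⟨c, rfl⟩ := Submodule.mem_span_singleton.1 hf'
  rw [eq_zero_of_smul_one_mem_zeroAtInfty hf.2, zero_smul]

/-! ### Behaviour of coefficients at infinity -/

namespace UnitaryRep

variable {G : Type u} [Group G] [TopologicalSpace G]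
variable {H : Type u} [NormedAddCommGroup H] [InnerProductSpace ℂ H]

theorem coeff_mem_fourierStieltjes [CompleteSpace H] (π : UnitaryRep G H) (ξ η : H) :
    π.coeff ξ η ∈ fourierStieltjes G :=
  ⟨H, inferInstance, inferInstance, inferInstance, π, ξ, η, rfl⟩

/-- If all matrix coefficients vanish at infinity, there is no nonzero finite dimensional
subrepresentation. -/
theorem isPurelyInfinite_of_coeff_mem_zeroAtInfty [NoncompactSpace G] (π : UnitaryRep G H)
    (h : ∀ ξ η : H, π.coeff ξ η ∈ zeroAtInfty G) : π.IsPurelyInfinite := by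
  intro W hW _
  rw [Submodule.eq_bot_iff]
  intro w hw
  let b := stdOrthonormalBasis ℂ W
  -- Parseval in the invariant space `W`: the sum does not depend on `s`, yet its finitely many
  -- terms tend to zero.
  have hnorm : ∀ s : G, ∑ i, ‖π.coeff w (b i : H) s‖ ^ 2 = ‖w‖ ^ 2 := by
    intro s
    have := b.sum_sq_norm_inner_right ((⟨π.toHom s w, hW s w hw⟩ : W))
    simpa [coeff] using this
  have h0 : Tendsto (fun s : G => ∑ i, ‖π.coeff w (b i : H) s‖ ^ 2) (cocompact G) (𝓝 0) := by
    have : Tendsto (fun s : G => ∑ i, ‖π.coeff w (b i : H) s‖ ^ 2) (cocompact G)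
        (𝓝 (∑ i : Fin (Module.finrank ℂ W), ‖(0 : ℂ)‖ ^ 2)) :=
      tendsto_finsetSum _ fun i _ => ((mem_zeroAtInfty_iff.1 (h w (b i))).2.norm).pow 2
    simpa using this
  simp_rw [hnorm] at h0
  have h1 : ‖w‖ ^ 2 = 0 := tendsto_nhds_unique tendsto_const_nhds h0
  simpa using h1

/-- If all matrix coefficients converge at infinity and there is no nonzero invariant vector, then
all matrix coefficients vanish at infinity: the weak limit of an orbit is invariant. -/
theorem coeff_mem_zeroAtInfty_of_tendsto [IsTopologicalGroup G] [NoncompactSpace G]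
    [CompleteSpace H] (π : UnitaryRep G H)
    (hlim : ∀ ξ η : H, ∃ c : ℂ, Tendsto (π.coeff ξ η) (cocompact G) (𝓝 c))
    (hinv : ¬ π.HasInvariantVector) (ξ η : H) : π.coeff ξ η ∈ zeroAtInfty G := by
  -- Conjugating makes the limit linear, not antilinear, in `η`, as Riesz representation requires.
  have hlim' : ∀ η : H, ∃ c : ℂ,
      Tendsto (fun s => inner ℂ (π.toHom s ξ) η) (cocompact G) (𝓝 c) := by
    intro η
    obtain ⟨c, hc⟩ := hlim ξ η
    refine ⟨star c, (hc.star).congr fun s => ?_⟩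
    simp [coeff]
  choose L hL using hlim'
  let Llin : H →ₗ[ℂ] ℂ :=
    { toFun := L
      map_add' := fun a b => tendsto_nhds_unique (hL (a + b))
        (((hL a).add (hL b)).congr fun s => by rw [inner_add_right])
      map_smul' := fun c a => tendsto_nhds_unique (hL (c • a))
        (((hL a).const_mul c).congr fun s => by rw [inner_smul_right]) }
  have hbound : ∀ x, ‖Llin x‖ ≤ ‖ξ‖ * ‖x‖ := fun x =>
    le_of_tendsto (hL x).norm (Eventually.of_forall fun s => by
      simpa using norm_inner_le_norm (𝕜 := ℂ) (π.toHom s ξ) x)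
  let ζ : H := (InnerProductSpace.toDual ℂ H).symm (Llin.mkContinuous ‖ξ‖ hbound)
  have hζ : ∀ x, inner ℂ ζ x = L x := fun x => by
    simp only [ζ, InnerProductSpace.toDual_symm_apply]
    rfl
  have hζinv : ∀ g, π.toHom g ζ = ζ := by
    intro g
    refine ext_inner_right ℂ fun x => ?_
    have h1 : inner ℂ (π.toHom g ζ) x = inner ℂ ζ (π.toHom g⁻¹ x) := by
      rw [inner_map_right, inv_inv]
    rw [h1, hζ, hζ]
    -- Left translation preserves infinity, so the orbit translated by `g` has the same weak limit.
    have hmul : Tendsto (fun s => g * s) (cocompact G) (cocompact G) :=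
      (Homeomorph.mulLeft g).isClosedEmbedding.tendsto_cocompact
    refine tendsto_nhds_unique (hL _) (((hL x).comp hmul).congr fun s => ?_)
    rw [Function.comp_apply, map_mul_apply, inner_map_right, inv_inv]
  have hζ0 : ζ = 0 := by
    by_contra hne
    exact hinv ⟨ζ, hne, hζinv⟩
  refine mem_zeroAtInfty_iff.2 ⟨π.continuous_coeff ξ η, ?_⟩
  have h0 : L η = 0 := by rw [← hζ, hζ0, inner_zero_left]
  have := (hL η).star
  rw [h0, star_zero] at this
  exact this.congr fun s => by simp [coeff]

end UnitaryRep

/-- A function on a compact group whose pullback to a noncompact group converges at infinity has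
constant pullback. -/
theorem eq_of_tendsto_comp_cocompact {G K : Type*} [Group G] [TopologicalSpace G]
    [IsTopologicalGroup G] [NoncompactSpace G] [Group K] [TopologicalSpace K]
    [IsTopologicalGroup K] [CompactSpace K] (φ : G →* K) {v : K → ℂ} (hv : Continuous v) {c : ℂ}
    (hc : Tendsto (fun g => v (φ g)) (cocompact G) (𝓝 c)) (g : G) : v (φ g) = c := by
  -- By compactness `φ` converges to some `k` along an ultrafilter going to infinity.
  let U : Ultrafilter G := Ultrafilter.of (cocompact G)
  have hU : (U : Filter G) ≤ cocompact G := Ultrafilter.of_le _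
  obtain ⟨k, -, hk⟩ := isCompact_univ.ultrafilter_le_nhds (U.map φ) (by simp)
  have hk : Tendsto φ U (𝓝 k) := hk
  have h1 : ∀ a : G, v ((φ a)⁻¹ * k * φ g) = c := by
    intro a
    have hmul : Tendsto (fun s => a⁻¹ * s * g) (cocompact G) (cocompact G) :=
      ((Homeomorph.mulLeft a⁻¹).trans (Homeomorph.mulRight g)).isClosedEmbedding.tendsto_cocompact
    have hA : Tendsto (fun s => v (φ (a⁻¹ * s * g))) U (𝓝 c) := hc.comp (hmul.mono_left hU)
    have hB : Tendsto (fun s => v ((φ a)⁻¹ * φ s * φ g)) U (𝓝 (v ((φ a)⁻¹ * k * φ g))) :=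
      (hv.tendsto _).comp ((hk.const_mul _).mul_const _)
    exact tendsto_nhds_unique hB (hA.congr fun s => by simp)
  -- Now `a` runs along `U` too, so that `(φ a)⁻¹ * k` tends to the identity.
  have h2 : Tendsto (fun a => v ((φ a)⁻¹ * k * φ g)) U (𝓝 (v (k⁻¹ * k * φ g))) :=
    (hv.tendsto _).comp ((hk.inv.mul_const _).mul_const _)
  simp_rw [h1] at h2
  have h3 : c = v (k⁻¹ * k * φ g) := tendsto_nhds_unique tendsto_const_nhds h2
  rw [h3, inv_mul_cancel, one_mul]

/-! ### The regular representation of a compact group -/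

section Regular

variable {K : Type u} [Group K] [TopologicalSpace K] [IsTopologicalGroup K] [CompactSpace K]
  [MeasurableSpace K] [BorelSpace K]

/-- The left regular representation of a compact group. -/
def regularRep (μ : Measure K) [μ.IsHaarMeasure] [μ.InnerRegularCompactLTTop] :
    UnitaryRep K (Lp ℂ 2 μ) where
  toHom :=
    { toFun := fun k =>
        { toFun := fun f => DomMulAct.mk k⁻¹ • f
          map_add' := fun a b => smul_add _ _ _
          map_smul' := fun c a => smul_comm _ _ _
          invFun := fun f => DomMulAct.mk k • f
          left_inv := fun f => by
            change DomMulAct.mk k • DomMulAct.mk k⁻¹ • f = f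
            rw [← mul_smul, ← DomMulAct.mk_mul, inv_mul_cancel, DomMulAct.mk_one, one_smul]
          right_inv := fun f => by
            change DomMulAct.mk k⁻¹ • DomMulAct.mk k • f = f
            rw [← mul_smul, ← DomMulAct.mk_mul, mul_inv_cancel, DomMulAct.mk_one, one_smul]
          norm_map' := fun f => DomMulAct.norm_smul_Lp _ f }
      map_one' := by
        apply LinearIsometryEquiv.ext
        intro f
        change DomMulAct.mk (1 : K)⁻¹ • f = f
        rw [inv_one, DomMulAct.mk_one, one_smul]
      map_mul' := fun a b => by
        apply LinearIsometryEquiv.ext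
        intro f
        change DomMulAct.mk (a * b)⁻¹ • f = DomMulAct.mk a⁻¹ • DomMulAct.mk b⁻¹ • f
        rw [mul_inv_rev, DomMulAct.mk_mul, mul_smul] }
  continuous_apply f := by
    have : Fact ((2 : ENNReal) ≠ ⊤) := ⟨by simp⟩
    have h : Continuous fun k : K => DomMulAct.mk k⁻¹ :=
      DomMulAct.continuous_mk.comp continuous_inv
    exact h.smul continuous_const

/-- The regular representation of a compact Hausdorff group is faithful. -/
theorem eq_one_of_regularRep_apply_eq [T2Space K] (μ : Measure K) [μ.IsHaarMeasure]
    [μ.InnerRegularCompactLTTop] {k : K} (h : ∀ f, (regularRep μ).toHom k f = f) : k = 1 := by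
  by_contra hk
  obtain ⟨f, hf0, hf1, -⟩ := exists_continuous_zero_one_of_isClosed
    (isClosed_singleton (x := k⁻¹)) (isClosed_singleton (x := (1 : K)))
    (by simpa using hk)
  let F : K → ℂ := fun x => (f x : ℂ)
  have hF : Continuous F := Complex.continuous_ofReal.comp f.continuous
  have hmem : MemLp F 2 μ :=
    hF.memLp_of_hasCompactSupport (HasCompactSupport.of_compactSpace F)
  have h1 := h (hmem.toLp F)
  change DomMulAct.mk k⁻¹ • hmem.toLp F = hmem.toLp F at h1
  rw [DomMulAct.mk_smul_toLp, MemLp.toLp_eq_toLp_iff] at h1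
  -- Haar measure charges nonempty open sets, so the almost everywhere equality holds at 1, where it
  -- reads `f k⁻¹ = f 1`.
  have h2 := (Continuous.ae_eq_iff_eq μ (hF.comp (continuous_const_smul k⁻¹)) hF).1 h1
  have h3 := congrFun h2 1
  have e0 : f k⁻¹ = 0 := hf0 rfl
  have e1 : f 1 = 1 := hf1 rfl
  simp [F, e0, e1] at h3

end Regular

/-! ### Minimal almost periodicity -/

section MinimallyAlmostPeriodic

variable {G : Type u} [Group G] [TopologicalSpace G]

theorem isMinimallyAlmostPeriodic_iff :
    IsMinimallyAlmostPeriodic G ↔ ∀ (i : CompactTarget G) (g : G), i.hom g = 1 := by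
  constructor
  · intro h i g
    have hg : toCompactTargets G g ∈ APCompactification G :=
      Subgroup.le_topologicalClosure _ ⟨g, rfl⟩
    have := congrArg Subtype.val (h.elim ⟨_, hg⟩ (1 : APCompactification G))
    exact congrFun this i
  · intro h
    have hrange : (toCompactTargets G).toMonoidHom.range = ⊥ := by
      rw [eq_bot_iff]
      rintro _ ⟨g, rfl⟩
      exact Subgroup.mem_bot.2 (funext fun i => h i g)
    have hbot : APCompactification G = ⊥ := by
      rw [APCompactification, hrange]
      exact SetLike.coe_injective (by simp [Subgroup.topologicalClosure_coe])
    unfold IsMinimallyAlmostPeriodic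
    rw [hbot]
    infer_instance

/-- If all matrix coefficients converge at infinity, then `G` is minimally almost periodic. -/
theorem isMinimallyAlmostPeriodic_of_tendsto [IsTopologicalGroup G] [NoncompactSpace G]
    (hlim : ∀ (H : Type u) [NormedAddCommGroup H] [InnerProductSpace ℂ H] [CompleteSpace H]
      (π : UnitaryRep G H) (ξ η : H),
      ∃ c : ℂ, Tendsto (π.coeff ξ η) (cocompact G) (𝓝 c)) :
    IsMinimallyAlmostPeriodic G := by
  rw [isMinimallyAlmostPeriodic_iff]
  intro i g
  borelize i.carrier
  refine eq_one_of_regularRep_apply_eq (Measure.haar : Measure i.carrier) fun f => ?_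
  set ρ := regularRep (Measure.haar : Measure i.carrier)
  refine ext_inner_left ℂ fun f' => ?_
  obtain ⟨c, hc⟩ := hlim _ (ρ.comap i.hom) f f'
  -- Constancy lets the values at `g` and at 1 be compared.
  have h : ∀ s, ρ.coeff f f' (i.hom s) = c := fun s =>
    eq_of_tendsto_comp_cocompact i.hom.toMonoidHom (ρ.continuous_coeff f f') hc s
  have h1 := h 1
  rw [map_one, UnitaryRep.coeff, UnitaryRep.map_one_apply] at h1
  exact (h g).trans h1.symm

/-- Unitaries form a closed subset of the unit ball, which is compact in finite dimension. -/
theorem isCompact_unitary (A : Type*) [CStarAlgebra A] [FiniteDimensional ℂ A] :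
    IsCompact (unitary A : Set A) := by
  have : ProperSpace A := FiniteDimensional.proper ℂ A
  refine (isCompact_closedBall (0 : A) 1).of_isClosed_subset (isClosed_unitary) fun u hu => ?_
  rw [mem_closedBall_zero_iff]
  rcases subsingleton_or_nontrivial A with _ | _
  · simp [Subsingleton.elim u 0]
  · exact (CStarRing.norm_of_mem_unitary hu).le

/-- The unitary group of a finite dimensional representation, as a compact target. -/
def unitaryTarget {W : Type u} [NormedAddCommGroup W] [InnerProductSpace ℂ W]
    [FiniteDimensional ℂ W] [CompleteSpace W] (π : UnitaryRep G W) : CompactTarget G :=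
  haveI : CompactSpace (unitary (W →L[ℂ] W)) :=
    isCompact_iff_compactSpace.1 (isCompact_unitary (W →L[ℂ] W))
  { carrier := unitary (W →L[ℂ] W)
    hom :=
      { toMonoidHom := Unitary.linearIsometryEquiv.symm.toMonoidHom.comp π.toHom
        continuous_toFun :=
          Continuous.subtype_mk (continuous_clm_apply.2 fun w => π.continuous_apply w) _ } }

/-- A representation of a minimally almost periodic group without nonzero invariant vectors is
purely infinite. -/
theorem IsMinimallyAlmostPeriodic.isPurelyInfinite (hG : IsMinimallyAlmostPeriodic G)
    {H : Type u} [NormedAddCommGroup H] [InnerProductSpace ℂ H] (π : UnitaryRep G H)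
    (hinv : ¬ π.HasInvariantVector) : π.IsPurelyInfinite := by
  intro W hW _
  have : CompleteSpace W := FiniteDimensional.complete ℂ W
  rw [Submodule.eq_bot_iff]
  intro w hw
  by_contra hne
  refine hinv ⟨w, hne, fun g => ?_⟩
  have h := isMinimallyAlmostPeriodic_iff.1 hG (unitaryTarget (π.restrict W hW)) g
  have h' := congrArg (fun u : unitary (W →L[ℂ] W) => ((u : W →L[ℂ] W) ⟨w, hw⟩ : H)) h
  exact h'

end MinimallyAlmostPeriodic

/-! ### Consequences of the decomposition and of Howe–Moore -/

section Equivalences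

variable {G : Type u} [Group G] [TopologicalSpace G]

theorem exists_tendsto_coeff_of_fourierStieltjes_eq
    (h : fourierStieltjes G = rajchman G ⊔ Submodule.span ℂ {(1 : G → ℂ)})
    {H : Type u} [NormedAddCommGroup H] [InnerProductSpace ℂ H] [CompleteSpace H]
    (π : UnitaryRep G H) (ξ η : H) :
    ∃ c : ℂ, Tendsto (π.coeff ξ η) (cocompact G) (𝓝 c) := by
  have hmem := π.coeff_mem_fourierStieltjes ξ η
  rw [h] at hmem
  obtain ⟨f, hf, f', hf', hsum⟩ := Submodule.mem_sup.1 hmem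
  obtain ⟨c, rfl⟩ := Submodule.mem_span_singleton.1 hf'
  refine ⟨c, ?_⟩
  have hlim := (mem_zeroAtInfty_iff.1 hf.2).2.add (tendsto_const_nhds (x := c))
  rw [zero_add] at hlim
  refine hlim.congr fun s => ?_
  simp [← hsum]

namespace HasHoweMooreProperty

theorem coeff_nontrivialPart_mem_rajchman (h : HasHoweMooreProperty G)
    {H : Type u} [NormedAddCommGroup H] [InnerProductSpace ℂ H] [CompleteSpace H]
    (π : UnitaryRep G H) (ξ η : π.invariantsᗮ) : π.nontrivialPart.coeff ξ η ∈ rajchman G :=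
  ⟨π.nontrivialPart.coeff_mem_fourierStieltjes ξ η,
    (h _ π.nontrivialPart).resolve_left π.not_hasInvariantVector_nontrivialPart ξ η⟩

theorem fourierStieltjes_eq (h : HasHoweMooreProperty G) :
    fourierStieltjes G = rajchman G ⊔ Submodule.span ℂ {(1 : G → ℂ)} := by
  apply le_antisymm
  · rintro _ ⟨H, _, _, _, π, ξ, η, rfl⟩
    obtain ⟨c, ξ', η', hsum⟩ := π.exists_coeff_eq_add_const ξ η
    rw [hsum]
    exact Submodule.add_mem_sup (h.coeff_nontrivialPart_mem_rajchman π ξ' η')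
      (Submodule.smul_mem _ _ (Submodule.mem_span_singleton_self _))
  · refine sup_le inf_le_left ((Submodule.span_singleton_le_iff_mem _ _).2 ?_)
    refine ⟨EuclideanSpace ℂ PUnit.{u + 1}, inferInstance, inferInstance, inferInstance,
      UnitaryRep.trivial G _, EuclideanSpace.single PUnit.unit 1,
      EuclideanSpace.single PUnit.unit 1, ?_⟩
    funext s
    simp [UnitaryRep.coeff, UnitaryRep.trivial]

theorem purelyInfiniteCoeffs_eq [NoncompactSpace G] (h : HasHoweMooreProperty G) :
    purelyInfiniteCoeffs G = (rajchman G : Set (G → ℂ)) := by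
  apply Set.Subset.antisymm
  · rintro _ ⟨H, _, _, _, π, ξ, η, hπ, rfl⟩
    exact ⟨π.coeff_mem_fourierStieltjes ξ η,
      (h H π).resolve_left hπ.not_hasInvariantVector ξ η⟩
  · rintro _ ⟨⟨H, _, _, _, π, ξ, η, rfl⟩, h0⟩
    obtain ⟨c, ξ', η', hsum⟩ := π.exists_coeff_eq_add_const ξ η
    have hc : c = 0 := by
      refine eq_zero_of_smul_one_mem_zeroAtInfty (G := G) ?_
      -- The constant is a difference of two `C₀` functions, so it vanishes on a noncompact group.
      rw [← add_sub_cancel_left (π.nontrivialPart.coeff ξ' η') (c • (1 : G → ℂ)), ← hsum]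
      exact Submodule.sub_mem _ h0 (h.coeff_nontrivialPart_mem_rajchman π ξ' η').2
    refine ⟨π.invariantsᗮ, inferInstance, inferInstance, inferInstance, π.nontrivialPart, ξ', η',
      π.nontrivialPart.isPurelyInfinite_of_coeff_mem_zeroAtInfty
        fun a b => (h.coeff_nontrivialPart_mem_rajchman π a b).2, ?_⟩
    rw [hsum, hc, zero_smul, add_zero]

end HasHoweMooreProperty

end Equivalences

end HoweMoore

end

theorem mainTheorem4 (G : Type u) [Group G] [TopologicalSpace G] [IsTopologicalGroup G]
    [LocallyCompactSpace G] [T2Space G] [NoncompactSpace G] :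
    List.TFAE
      [HoweMoore.HasHoweMooreProperty G,
       HoweMoore.fourierStieltjes G
            = HoweMoore.rajchman G ⊔ Submodule.span ℂ {(1 : G → ℂ)} ∧
          Disjoint (HoweMoore.rajchman G) (Submodule.span ℂ {(1 : G → ℂ)}),
       HoweMoore.IsMinimallyAlmostPeriodic G ∧
          HoweMoore.purelyInfiniteCoeffs G = (HoweMoore.rajchman G : Set (G → ℂ))] := by
  tfae_have 1 → 2 := fun h => ⟨h.fourierStieltjes_eq, HoweMoore.disjoint_rajchman_span_one G⟩
  tfae_have 2 → 1 := fun h H _ _ _ π => or_iff_not_imp_left.2 fun hinv =>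
    π.coeff_mem_zeroAtInfty_of_tendsto
      (HoweMoore.exists_tendsto_coeff_of_fourierStieltjes_eq h.1 π) hinv
  tfae_have 1 → 3 := fun h =>
    ⟨HoweMoore.isMinimallyAlmostPeriodic_of_tendsto fun _ _ _ _ π =>
      HoweMoore.exists_tendsto_coeff_of_fourierStieltjes_eq h.fourierStieltjes_eq π,
      h.purelyInfiniteCoeffs_eq⟩
  tfae_have 3 → 1 := by
    rintro ⟨hmap, heq⟩ H _ _ _ π
    refine or_iff_not_imp_left.2 fun hinv ξ η => ?_
    have hmem : π.coeff ξ η ∈ HoweMoore.purelyInfiniteCoeffs G :=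
      ⟨H, inferInstance, inferInstance, inferInstance, π, ξ, η, hmap.isPurelyInfinite π hinv, rfl⟩
    rw [heq] at hmem
    exact hmem.2
  tfae_finish
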